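/- Let $\mathbb{H}$ be the quaternions, $\mathbb{B}=\{q\in\mathbb{H}:|q|<1\}$, $\mathbb{S}=\{I\in\mathbb{H}: I^2=-1\}$. A function $f:\mathbb{B}\to\mathbb{H}$ is (slice) regular if for every $I\in\mathbb{S}$ its restriction $f_I$ to $\mathbb{B}\cap(\mathbb{R}+I\mathbb{R})$ is real differentiable and $\frac12\left(\frac{\partial}{\partial x}+I\frac{\partial}{\partial y}\right)f_I(x+Iy)=0$. Such functions are exactly the power series $f(q)=\sum_{n} q^na_n$, $a_n\in\mathbb{H}$, converging on $\mathbb{B}$. For $f=\sum q^na_n$ and $g=\sum q^nb_n$ put $f*g=\sum_n q^n\sum_{k=0}^n a_kb_{n-k}$, $f^c=\sum_n q^n\bar a_n$, $f^s=f*f^c$, and, where $f^s(q)\neq0$, $f^{-*}*g(q)=f^s(q)^{-1}\,(f^c*g)(q)$ and $f^{-*}=f^{-*}*1$. If $f^{-*}*g$ (with $f\not\equiv 0$) has a regular extension to all of $\mathbb{B}$, the extension is unique and is denoted by the same symbol. For $q_0\in\mathbb{B}$ put $$\mathcal{M}_{q_0}(q)=(q-q_0)*(1-q\bar q_0)^{-*},\qquad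 R_{q_0}f(q)=(q-q_0)^{-*}*(f(q)-f(q_0)),$$ $$\partial_cf(x+Iy)=\tfrac12\left(\tfrac{\partial}{\partial x}-I\tfrac{\partial}{\partial y}\right)f(x+Iy)\quad (I\in\mathbb{S}),\qquad \partial_sf(q)=(2\,\mathrm{Im}\,q)^{-1}(f(q)-f(\bar q))\quad (q\notin\mathbb{R}),$$ with $\partial_s f$ extended continuously to real points, i.e. $\partial_sf(q)=\partial_cf(q)$ for $q\in\mathbb{R}$. **Theorem.** Let $f:\mathbb{B}\to\mathbb{B}$ be regular, let $q_0\in\mathbb{B}$ and suppose $f(q_0)=0$. Then: 1. $\mathcal{M}_{q_0}^{-*}*f$ extends to a regular function on $\mathbb{B}$, and $|\mathcal{M}_{q_0}^{-*}*f(q)|\le 1$ for all $q\in\mathbb{B}$. The inequality is strict at every $q\in\mathbb{B}$, unless $\mathcal{M}_{q_0}^{-*}*f\equiv u$ on $\mathbb{B}$ for some $u\in\mathbb{H}$ with $|u|=1$. 2. $|f(q)|\le|\mathcal{M}_{q_0}(q)|$ for all $q\in\mathbb{B}$. 3. $R_{q_0}f$ extends to a regular function on $\mathbb{B}$, and $|R_{q_0}f(q)|\le|(1-q\bar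 q_0)^{-*}|$ for all $q\in\mathbb{B}$. 4. $|\partial_cf(q_0)|\le\dfrac{1}{1-|q_0|^2}$ and $|\partial_sf(q_0)|\le\dfrac{1}{|1-\bar q_0^{\,2}|}$. Moreover, unless there is $u\in\mathbb{H}$ with $|u|=1$ such that $f(q)=\mathcal{M}_{q_0}(q)\,u$ for all $q\in\mathbb{B}$, all of these inequalities are strict: those in 1 and 3 at every $q\in\mathbb{B}$, the one in 2 at every $q\in\mathbb{B}\setminus\{q_0\}$, and both in 4. -/

import Mathlib

open scoped Quaternion

namespace SliceRegular

/-- The open unit ball `𝔹` of the quaternions. -/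
def unitBall : Set ℍ := {q | ‖q‖ < 1}

/-- The sphere `𝕊` of imaginary units. -/
def imagUnits : Set ℍ := {I | I ^ 2 = -1}

/-- The point `x + I y` of the plane `L_I`. -/
noncomputable def slicePoint (I : ℍ) (x y : ℝ) : ℍ := (x : ℍ) + I * (y : ℍ)

/-- `∂/∂x` of the restriction `f_I` at `x + I y`. -/
noncomputable def partialX (f : ℍ → ℍ) (I : ℍ) (x y : ℝ) : ℍ :=
  deriv (fun t : ℝ => f (slicePoint I t y)) x

/-- `∂/∂y` of the restriction `f_I` at `x + I y`. -/
noncomputable def partialY (f : ℍ → ℍ) (I : ℍ) (x y : ℝ) : ℍ :=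
  deriv (fun t : ℝ => f (slicePoint I x t)) y

/-- Slice regularity of `f` on an open set `Ω`: for every imaginary unit `I`, the restriction of
`f` to `Ω ∩ L_I` is real differentiable and `(1/2) (∂/∂x + I ∂/∂y) f_I` vanishes identically.
Only the values of `f` on `Ω` matter. -/
def IsRegularOn (f : ℍ → ℍ) (Ω : Set ℍ) : Prop :=
  ∀ I ∈ imagUnits, ∀ x y : ℝ, slicePoint I x y ∈ Ω →
    DifferentiableAt ℝ (fun p : ℝ × ℝ => f (slicePoint I p.1 p.2)) (x, y) ∧
      (1 / 2 : ℝ) • (partialX f I x y + I * partialY f I x y) = 0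

/-- `f(q) = ∑ qⁿ aₙ` for all `q ∈ 𝔹`. -/
def HasExpansion (f : ℍ → ℍ) (a : ℕ → ℍ) : Prop :=
  ∀ q ∈ unitBall, HasSum (fun n => q ^ n * a n) (f q)

open Classical in
/-- The coefficients `aₙ` of the (unique) expansion `f(q) = ∑ qⁿ aₙ` on `𝔹`, which exists when
`f` is regular on `𝔹`; zero if there is no expansion. -/
noncomputable def coeffs (f : ℍ → ℍ) : ℕ → ℍ :=
  if h : ∃ a, HasExpansion f a then h.choose else 0

/-- The regular product `f * g (q) = ∑ qⁿ ∑_{k ≤ n} a_k b_{n-k}`. -/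
noncomputable def regMul (f g : ℍ → ℍ) (q : ℍ) : ℍ :=
  ∑' n : ℕ, q ^ n * ∑ k ∈ Finset.range (n + 1), coeffs f k * coeffs g (n - k)

/-- The regular conjugate `f^c (q) = ∑ qⁿ (conjugate of aₙ)`. -/
noncomputable def regConj (f : ℍ → ℍ) (q : ℍ) : ℍ :=
  ∑' n : ℕ, q ^ n * star (coeffs f n)

/-- The symmetrization `f^s = f * f^c`. -/
noncomputable def symmetrization (f : ℍ → ℍ) : ℍ → ℍ := regMul f (regConj f)

/-- The left regular quotient `f^{-*} * g (q) = (f^s(q))⁻¹ (f^c * g)(q)`. As a function it is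
meaningful at the points of `𝔹` where `f^s` does not vanish. -/
noncomputable def leftQuotient (f g : ℍ → ℍ) (q : ℍ) : ℍ :=
  (symmetrization f q)⁻¹ * regMul (regConj f) g q

/-- The regular reciprocal `f^{-*} = f^{-*} * 1`. -/
noncomputable def regRecip (f : ℍ → ℍ) : ℍ → ℍ := leftQuotient f (fun _ => 1)

/-- `h` is the function `f^{-*} * g`, regarded as a regular function on all of `𝔹`: it is regular
on `𝔹` and agrees with the left regular quotient wherever the latter is defined, that is, off the
zero set of `f^s`. For `f ≢ 0` there is at most one such function on `𝔹`. -/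
def IsQuotientOnBall (f g h : ℍ → ℍ) : Prop :=
  IsRegularOn h unitBall ∧
    ∀ q ∈ unitBall, symmetrization f q ≠ 0 → h q = leftQuotient f g q

/-- `h` is the differential quotient `R_{q₀} f = (q - q₀)^{-*} * (f(q) - f(q₀))` on `𝔹`. -/
def IsDifferentialQuotient (f : ℍ → ℍ) (q₀ : ℍ) (h : ℍ → ℍ) : Prop :=
  IsQuotientOnBall (fun q => q - q₀) (fun q => f q - f q₀) h

/-- The regular function `1 - q q̄₀`. -/
noncomputable def moebiusDenom (q₀ : ℍ) (q : ℍ) : ℍ := 1 - q * star q₀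

/-- The regular Möbius transformation `𝓜_{q₀}(q) = (q - q₀) * (1 - q q̄₀)^{-*}`. -/
noncomputable def moebius (q₀ : ℍ) : ℍ → ℍ :=
  regMul (fun q => q - q₀) (regRecip (moebiusDenom q₀))

/-- The quaternion `i`. -/
def unitI : ℍ := ⟨0, 1, 0, 0⟩

open Classical in
/-- An imaginary unit `I` with `q = Re q + I |Im q|`; for real `q` any unit would do. -/
noncomputable def sliceUnit (q : ℍ) : ℍ :=
  if q.im = 0 then unitI else ‖q.im‖⁻¹ • q.im

theorem sliceUnit_mem (q : ℍ) : sliceUnit q ∈ imagUnits := by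
  show sliceUnit q ^ 2 = -1
  unfold sliceUnit
  split_ifs with h
  · have h0 : unitI.re = 0 := rfl
    have h1 : unitI.imI = 1 := rfl
    have h2 : unitI.imJ = 0 := rfl
    have h3 : unitI.imK = 0 := rfl
    ext <;> simp [pow_two, h0, h1, h2, h3]
  · have h1 : ‖q.im‖ ≠ 0 := norm_ne_zero_iff.mpr h
    rw [smul_pow, Quaternion.im_sq, Quaternion.normSq_eq_norm_mul_self, smul_neg,
      Quaternion.smul_coe, ← pow_two, ← mul_pow, inv_mul_cancel₀ h1]
    simp

theorem slicePoint_sliceUnit (q : ℍ) : slicePoint (sliceUnit q) q.re ‖q.im‖ = q := by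
  unfold slicePoint sliceUnit
  split_ifs with h
  · have h1 := Quaternion.re_add_im q
    rw [h, add_zero] at h1
    rw [h, norm_zero, Quaternion.coe_zero, mul_zero, add_zero, h1]
  · have h1 : ‖q.im‖ ≠ 0 := norm_ne_zero_iff.mpr h
    rw [Quaternion.mul_coe_eq_smul, smul_smul, mul_inv_cancel₀ h1, one_smul,
      Quaternion.re_add_im]

/-- The Cullen derivative `∂_c f (x + I y) = (1/2) (∂/∂x - I ∂/∂y) f (x + I y)`. For regular `f`
the value does not depend on how the point is written as `x + I y`. -/
noncomputable def cullenDeriv (f : ℍ → ℍ) (q : ℍ) : ℍ :=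
  (1 / 2 : ℝ) • (partialX f (sliceUnit q) q.re ‖q.im‖
    - sliceUnit q * partialY f (sliceUnit q) q.re ‖q.im‖)

open Classical in
/-- The spherical derivative `∂_s f (q) = (2 Im q)⁻¹ (f(q) - f(q̄))`, extended continuously to the
real points, where (for regular `f`) it takes the value of the Cullen derivative. -/
noncomputable def sphericalDeriv (f : ℍ → ℍ) (q : ℍ) : ℍ :=
  if q.im = 0 then cullenDeriv f q else (2 * q.im)⁻¹ * (f q - f (star q))

/-- `f = 𝓜_{q₀} · u` on `𝔹` for some `u` with `|u| = 1`. -/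
def IsMoebiusMulUnit (f : ℍ → ℍ) (q₀ : ℍ) : Prop :=
  ∃ u : ℍ, ‖u‖ = 1 ∧ ∀ q ∈ unitBall, f q = moebius q₀ q * u

end SliceRegular

/-!
A regular function on the ball is the same as a power series over `ℍ` in a central variable with
radius of convergence at least one (`IsRegularOn.exists_represents`, `Represents.isRegularOn`), and
the regular product is the product of the ring `ℍ⟦X⟧`, which has no zero divisors. Values of a
product are governed by `(φ * ψ)(q) = φ(q) ψ(φ(q)⁻¹ q φ(q))` if `φ(q) ≠ 0`, and `(φ * ψ)(q) = 0`
otherwise (`evalAt_mul`, `evalAt_mul_of_eq_zero`).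

As `f(q₀) = 0`, there is a factorization `f = (q - q₀) * β` (`linSeries_mul_divLinear`), and `β` is
the differential quotient of `f`. The series `1 - q q̄₀` is invertible and commutes with `q - q₀`.
So `η = (1 - q q̄₀) * β` satisfies
* `f = 𝓜_{q₀} * η`, hence `η = 𝓜_{q₀}^{-*} * f`,
* `β = (1 - q q̄₀)^{-*} * η`,
* `(1 - q q̄₀) * f = (q - q₀) * η`.

Evaluating the last identity, every value `η(w)` with `|w| > |q₀|` is bounded by
`|1 - q q̄₀| / |q - q₀|` for some `q` with `|q| = |w|`, and this ratio tends to one at the boundary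
of the ball (`norm_sq_evalAt_le`). The slices of a regular function are holomorphic maps into `ℍ`
with a complex structure, so the maximum principle gives `|η| ≤ 1` (`norm_evalAt_le_one`), and the
strong maximum principle shows that equality at one point forces `η` to be a constant `u` of modulus
one (`ConvergesOnBall.eq_C_of_norm_eq_one`), in which case `f = 𝓜_{q₀} u`.

The bounds on `f` and `β` follow, because multiplying on the right by a series bounded by one does
not increase the modulus at any point (`norm_evalAt_mul_le`, `norm_evalAt_mul_lt`). On the slice of
`q₀` the product `(q - q₀) * β` is pointwise, so that `∂_c f(q₀) = β(q₀)` and `∂_s f(q₀) = β(q̄₀)`;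
the bounds on the derivatives are those on `β` at `q₀` and `q̄₀`.
-/

namespace SliceRegular

open PowerSeries Filter Topology

/-! ### Convergent power series over the quaternions -/

/-- The formal series `∑ xⁿ aₙ` in one real variable. -/
noncomputable def realSeries {E : Type*} [NormedAddCommGroup E] [NormedSpace ℝ E] (a : ℕ → E) :
    FormalMultilinearSeries ℝ ℝ E := fun n => ContinuousMultilinearMap.mkPiRing ℝ (Fin n) (a n)

theorem coeff_realSeries {E : Type*} [NormedAddCommGroup E] [NormedSpace ℝ E] (a : ℕ → E)
    (n : ℕ) : (realSeries a).coeff n = a n := by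
  simp [FormalMultilinearSeries.coeff, realSeries]

/-- Two power series with vector coefficients and the same sum on `(-1, 1)` have the same
coefficients. -/
theorem coeff_eq_of_hasSum_real {E : Type*} [NormedAddCommGroup E] [NormedSpace ℝ E]
    {a b : ℕ → E} {f : ℝ → E}
    (ha : ∀ x : ℝ, |x| < 1 → HasSum (fun n => x ^ n • a n) (f x))
    (hb : ∀ x : ℝ, |x| < 1 → HasSum (fun n => x ^ n • b n) (f x)) : a = b := by
  have key : ∀ c : ℕ → E, (∀ x : ℝ, |x| < 1 → HasSum (fun n => x ^ n • c n) (f x)) →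
      HasFPowerSeriesAt f (realSeries c) 0 := by
    intro c hc
    refine hasFPowerSeriesAt_iff.2 ?_
    filter_upwards [Metric.ball_mem_nhds (0 : ℝ) one_pos] with x hx
    simpa [coeff_realSeries] using hc x (by simpa using hx)
  have h := (key a ha).eq_formalMultilinearSeries (key b hb)
  funext n
  simpa only [coeff_realSeries] using
    congrArg (fun p : FormalMultilinearSeries ℝ ℝ E => p.coeff n) h

/-- The radius of convergence is at least one, expressed by absolute convergence at every radius
below one. -/
def ConvergesOnBall (φ : ℍ⟦X⟧) : Prop :=
  ∀ r : ℝ, 0 ≤ r → r < 1 → Summable fun n => ‖coeff n φ‖ * r ^ n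

/-- The value `∑ qⁿ aₙ` at `q` of the power series with right coefficients `aₙ`. The formal
variable is central, so that multiplication of power series models the regular product. -/
noncomputable def evalAt (φ : ℍ⟦X⟧) (q : ℍ) : ℍ := ∑' n, q ^ n * coeff n φ

/-- For convergence on the ball it is enough that `|aₙ| ρⁿ` is bounded in `n` for radii `ρ`
arbitrarily close to one. -/
theorem convergesOnBall_of_bound {φ : ℍ⟦X⟧}
    (h : ∀ ρ : ℝ, 0 < ρ → ρ < 1 → ∃ ρ' C : ℝ, ρ ≤ ρ' ∧ ∀ n, ‖coeff n φ‖ * ρ' ^ n ≤ C) :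
    ConvergesOnBall φ := by
  intro r hr0 hr1
  obtain ⟨ρ, hρ, hρ1⟩ := exists_between hr1
  have hρ0 : 0 < ρ := hr0.trans_lt hρ
  obtain ⟨ρ', C, hρ', hC⟩ := h ρ hρ0 hρ1
  have hρ'0 : 0 < ρ' := hρ0.trans_le hρ'
  have hq : r / ρ' < 1 := (div_lt_one hρ'0).2 (hρ.trans_le hρ')
  refine Summable.of_nonneg_of_le (fun n => by positivity) (fun n => ?_)
    ((summable_geometric_of_lt_one (by positivity) hq).mul_left C)
  calc ‖coeff n φ‖ * r ^ n = (‖coeff n φ‖ * ρ' ^ n) * (r / ρ') ^ n := by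
        rw [div_pow]; field_simp
    _ ≤ C * (r / ρ') ^ n := by gcongr; exact hC n

theorem ConvergesOnBall.bound {φ : ℍ⟦X⟧} (h : ConvergesOnBall φ) {ρ : ℝ} (h0 : 0 ≤ ρ)
    (h1 : ρ < 1) : ∃ C, ∀ n, ‖coeff n φ‖ * ρ ^ n ≤ C := by
  obtain ⟨C, hC⟩ := (h ρ h0 h1).tendsto_atTop_zero.bddAbove_range
  exact ⟨C, fun n => hC ⟨n, rfl⟩⟩

theorem ConvergesOnBall.summable_norm {φ : ℍ⟦X⟧} (h : ConvergesOnBall φ) {q : ℍ}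
    (hq : ‖q‖ < 1) : Summable fun n => ‖q ^ n * coeff n φ‖ := by
  refine (h ‖q‖ (norm_nonneg q) hq).congr fun n => ?_
  rw [norm_mul, norm_pow, mul_comm]

theorem ConvergesOnBall.hasSum {φ : ℍ⟦X⟧} (h : ConvergesOnBall φ) {q : ℍ} (hq : ‖q‖ < 1) :
    HasSum (fun n => q ^ n * coeff n φ) (evalAt φ q) :=
  (h.summable_norm hq).of_norm.hasSum

theorem ConvergesOnBall.hasExpansion {φ : ℍ⟦X⟧} (h : ConvergesOnBall φ) :
    HasExpansion (evalAt φ) (fun n => coeff n φ) := fun _ hq => h.hasSum hq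

/-- A function with an expansion is the sum of a convergent power series. -/
theorem HasExpansion.convergesOnBall {f : ℍ → ℍ} {a : ℕ → ℍ} (h : HasExpansion f a) :
    ConvergesOnBall (PowerSeries.mk a) := by
  refine convergesOnBall_of_bound fun ρ h0 h1 => ?_
  have hn : ‖((ρ : ℝ) : ℍ)‖ = ρ := by rw [Quaternion.norm_coe, Real.norm_of_nonneg h0.le]
  have hs := (h (ρ : ℍ) (show ‖((ρ : ℝ) : ℍ)‖ < 1 by rwa [hn])).summable
  obtain ⟨C, hC⟩ := hs.tendsto_atTop_zero.norm.bddAbove_range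
  refine ⟨ρ, C, le_rfl, fun n => ?_⟩
  have := hC ⟨n, rfl⟩
  simpa [norm_mul, norm_pow, hn, mul_comm, abs_of_pos h0] using this

theorem HasExpansion.evalAt_eq {f : ℍ → ℍ} {a : ℕ → ℍ} (h : HasExpansion f a) {q : ℍ}
    (hq : ‖q‖ < 1) : evalAt (PowerSeries.mk a) q = f q := by
  simpa [evalAt] using (h q hq).tsum_eq

theorem HasExpansion.hasSum_real {f : ℍ → ℍ} {a : ℕ → ℍ} (h : HasExpansion f a) {x : ℝ}
    (hx : |x| < 1) : HasSum (fun n => x ^ n • a n) (f (x : ℍ)) := by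
  convert h (x : ℍ) (show ‖((x : ℝ) : ℍ)‖ < 1 by rwa [Quaternion.norm_coe]) using 2 with n
  rw [← Quaternion.coe_pow, Quaternion.coe_mul_eq_smul]

theorem HasExpansion.unique {f : ℍ → ℍ} {a b : ℕ → ℍ} (ha : HasExpansion f a)
    (hb : HasExpansion f b) : a = b :=
  coeff_eq_of_hasSum_real (f := fun x : ℝ => f (x : ℍ)) (fun _ => ha.hasSum_real)
    (fun _ => hb.hasSum_real)

/-- `f` is given on the ball by the convergent power series `φ`. -/
def Represents (φ : ℍ⟦X⟧) (f : ℍ → ℍ) : Prop :=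
  ConvergesOnBall φ ∧ ∀ q : ℍ, ‖q‖ < 1 → f q = evalAt φ q

theorem Represents.hasExpansion {φ : ℍ⟦X⟧} {f : ℍ → ℍ} (h : Represents φ f) :
    HasExpansion f (fun n => coeff n φ) := fun q hq => by
  rw [h.2 q hq]; exact h.1.hasSum hq

theorem HasExpansion.represents {f : ℍ → ℍ} {a : ℕ → ℍ} (h : HasExpansion f a) :
    Represents (PowerSeries.mk a) f := ⟨h.convergesOnBall, fun _ hq => (h.evalAt_eq hq).symm⟩

theorem Represents.unique {φ ψ : ℍ⟦X⟧} {f : ℍ → ℍ} (h : Represents φ f) (h' : Represents ψ f) :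
    φ = ψ :=
  PowerSeries.ext fun n => congrFun (h.hasExpansion.unique h'.hasExpansion) n

theorem Represents.coeffs_eq {φ : ℍ⟦X⟧} {f : ℍ → ℍ} (h : Represents φ f) :
    coeffs f = fun n => coeff n φ := by
  have hex : ∃ a, HasExpansion f a := ⟨_, h.hasExpansion⟩
  rw [coeffs, dif_pos hex]
  exact hex.choose_spec.unique h.hasExpansion

/-! ### The regular product of power series -/

theorem ConvergesOnBall.mul {φ ψ : ℍ⟦X⟧} (hφ : ConvergesOnBall φ) (hψ : ConvergesOnBall ψ) :
    ConvergesOnBall (φ * ψ) := by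
  intro r h0 h1
  have h := summable_norm_sum_mul_antidiagonal_of_summable_norm
    (f := fun n => ‖coeff n φ‖ * r ^ n) (g := fun n => ‖coeff n ψ‖ * r ^ n)
    (hφ r h0 h1).norm (hψ r h0 h1).norm
  refine Summable.of_nonneg_of_le (fun n => by positivity) (fun n => ?_) h
  rw [coeff_mul]
  refine le_trans ?_ (le_abs_self _)
  calc ‖∑ p ∈ Finset.HasAntidiagonal.antidiagonal n, coeff p.1 φ * coeff p.2 ψ‖ * r ^ n
      ≤ (∑ p ∈ Finset.HasAntidiagonal.antidiagonal n, ‖coeff p.1 φ‖ * ‖coeff p.2 ψ‖) * r ^ n := by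
        gcongr
        exact (norm_sum_le _ _).trans_eq (by simp_rw [norm_mul])
    _ = _ := by
        rw [Finset.sum_mul]
        refine Finset.sum_congr rfl fun p hp => ?_
        rw [← Finset.HasAntidiagonal.mem_antidiagonal.1 hp, pow_add]
        ring

/-- The pointwise description of the regular product:
`(φ * ψ)(q) = ∑ qᵏ φ(q) bₖ`, where `bₖ` are the coefficients of `ψ`. -/
theorem evalAt_mul_eq_tsum {φ ψ : ℍ⟦X⟧} (hφ : ConvergesOnBall φ) (hψ : ConvergesOnBall ψ) {q : ℍ}
    (hq : ‖q‖ < 1) : evalAt (φ * ψ) q = ∑' k, q ^ k * evalAt φ q * coeff k ψ := by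
  have hs : Summable fun p : ℕ × ℕ => q ^ (p.1 + p.2) * (coeff p.1 φ * coeff p.2 ψ) := by
    have h : Summable fun p : ℕ × ℕ =>
        (‖coeff p.1 φ‖ * ‖q‖ ^ p.1) * (‖coeff p.2 ψ‖ * ‖q‖ ^ p.2) :=
      (hφ ‖q‖ (norm_nonneg q) hq).mul_of_nonneg (hψ ‖q‖ (norm_nonneg q) hq)
        (fun n => by positivity) (fun n => by positivity)
    refine Summable.of_norm (h.congr fun p => ?_)
    rw [norm_mul, norm_mul, norm_pow, pow_add]
    ring
  have h1 : evalAt (φ * ψ) q = ∑' p : ℕ × ℕ, q ^ (p.1 + p.2) * (coeff p.1 φ * coeff p.2 ψ) := by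
    set F : ℕ × ℕ → ℍ := fun p => q ^ (p.1 + p.2) * (coeff p.1 φ * coeff p.2 ψ)
    let e := Finset.HasAntidiagonal.sigmaAntidiagonalEquivProd (A := ℕ)
    refine Eq.symm ((e.tsum_eq F).symm.trans ((Summable.tsum_sigma' (f := F ∘ e)
      (fun _ => Summable.of_finite) (e.summable_iff.2 hs)).trans (tsum_congr fun n => ?_)))
    rw [coeff_mul, Finset.mul_sum, tsum_fintype]
    refine (Finset.sum_congr rfl fun p _ => ?_).trans
      (Finset.sum_coe_sort _ fun p : ℕ × ℕ => q ^ n * (coeff p.1 φ * coeff p.2 ψ))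
    have := Finset.HasAntidiagonal.mem_antidiagonal.1 p.2
    simp [F, e, this]
  rw [h1, ← (Equiv.prodComm ℕ ℕ).tsum_eq,
    Summable.tsum_prod' (f := fun p : ℕ × ℕ => q ^ ((Equiv.prodComm ℕ ℕ p).1 +
      (Equiv.prodComm ℕ ℕ p).2) * (coeff (Equiv.prodComm ℕ ℕ p).1 φ *
        coeff (Equiv.prodComm ℕ ℕ p).2 ψ)) ((Equiv.prodComm ℕ ℕ).summable_iff.2 hs) ?_]
  · refine tsum_congr fun k => ?_
    rw [evalAt, ← tsum_mul_left, ← tsum_mul_right]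
    refine tsum_congr fun n => ?_
    simp only [Equiv.prodComm_apply, Prod.swap_prod_mk]
    rw [add_comm n k, pow_add]
    simp only [mul_assoc]
  · intro k
    exact ((Equiv.prodComm ℕ ℕ).summable_iff.2 hs).prod_factor k

theorem evalAt_mul_of_eq_zero {φ ψ : ℍ⟦X⟧} (hφ : ConvergesOnBall φ) (hψ : ConvergesOnBall ψ)
    {q : ℍ} (hq : ‖q‖ < 1) (h : evalAt φ q = 0) : evalAt (φ * ψ) q = 0 := by
  rw [evalAt_mul_eq_tsum hφ hψ hq]
  simp [h]

/-- Off the zeros of `φ`, the regular product is a pointwise product after the rotation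
`q ↦ φ(q)⁻¹ q φ(q)` of the argument in the second factor. -/
theorem evalAt_mul {φ ψ : ℍ⟦X⟧} (hφ : ConvergesOnBall φ) (hψ : ConvergesOnBall ψ)
    {q : ℍ} (hq : ‖q‖ < 1) (h : evalAt φ q ≠ 0) :
    evalAt (φ * ψ) q = evalAt φ q * evalAt ψ ((evalAt φ q)⁻¹ * q * evalAt φ q) := by
  rw [evalAt_mul_eq_tsum hφ hψ hq, evalAt.eq_def ψ, ← tsum_mul_left]
  refine tsum_congr fun k => ?_
  set c := evalAt φ q
  have hc : c * (c⁻¹ * q * c) ^ k = q ^ k * c := by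
    induction k with
    | zero => simp
    | succ k ih =>
      rw [pow_succ, ← mul_assoc, ih, pow_succ]
      simp only [mul_assoc]
      rw [mul_inv_cancel_left₀ h]
  rw [← mul_assoc, hc]

/-- If the value of the first factor commutes with the argument, the regular product is the
pointwise product. -/
theorem evalAt_mul_of_commute {φ ψ : ℍ⟦X⟧} (hφ : ConvergesOnBall φ) (hψ : ConvergesOnBall ψ)
    {q : ℍ} (hq : ‖q‖ < 1) (h : Commute q (evalAt φ q)) :
    evalAt (φ * ψ) q = evalAt φ q * evalAt ψ q := by
  rw [evalAt_mul_eq_tsum hφ hψ hq, evalAt.eq_def ψ, ← tsum_mul_left]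
  refine tsum_congr fun k => ?_
  rw [(h.pow_left k).eq, mul_assoc]

theorem norm_inv_mul_mul {c : ℍ} (hc : c ≠ 0) (q : ℍ) : ‖c⁻¹ * q * c‖ = ‖q‖ := by
  have : ‖c‖ ≠ 0 := norm_ne_zero_iff.2 hc
  rw [norm_mul, norm_mul, norm_inv]
  field_simp

theorem norm_evalAt_mul_le {φ η : ℍ⟦X⟧} (hφ : ConvergesOnBall φ) (hη : ConvergesOnBall η)
    (hB : ∀ q : ℍ, ‖q‖ < 1 → ‖evalAt η q‖ ≤ 1) {q : ℍ} (hq : ‖q‖ < 1) :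
    ‖evalAt (φ * η) q‖ ≤ ‖evalAt φ q‖ := by
  by_cases h : evalAt φ q = 0
  · rw [evalAt_mul_of_eq_zero hφ hη hq h, h]
  · rw [evalAt_mul hφ hη hq h, norm_mul]
    exact mul_le_of_le_one_right (norm_nonneg _) (hB _ (by rwa [norm_inv_mul_mul h]))

theorem norm_evalAt_mul_lt {φ η : ℍ⟦X⟧} (hφ : ConvergesOnBall φ) (hη : ConvergesOnBall η)
    (hB : ∀ q : ℍ, ‖q‖ < 1 → ‖evalAt η q‖ < 1) {q : ℍ} (hq : ‖q‖ < 1) (h : evalAt φ q ≠ 0) :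
    ‖evalAt (φ * η) q‖ < ‖evalAt φ q‖ := by
  rw [evalAt_mul hφ hη hq h, norm_mul]
  exact mul_lt_of_lt_one_right (norm_pos_iff.2 h) (hB _ (by rwa [norm_inv_mul_mul h]))

theorem Represents.regMul {φ ψ : ℍ⟦X⟧} {f g : ℍ → ℍ} (hf : Represents φ f)
    (hg : Represents ψ g) : Represents (φ * ψ) (SliceRegular.regMul f g) := by
  refine ⟨hf.1.mul hg.1, fun q _ => ?_⟩
  rw [SliceRegular.regMul, evalAt]
  refine tsum_congr fun n => ?_
  rw [hf.coeffs_eq, hg.coeffs_eq, coeff_mul, Finset.Nat.sum_antidiagonal_eq_sum_range_succ_mk]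

/-! ### Conjugation, symmetrization and quotients -/

/-- The regular conjugate of a power series. -/
noncomputable def seriesConj (φ : ℍ⟦X⟧) : ℍ⟦X⟧ := PowerSeries.mk fun n => star (coeff n φ)

@[simp]
theorem coeff_seriesConj (φ : ℍ⟦X⟧) (n : ℕ) : coeff n (seriesConj φ) = star (coeff n φ) := by
  simp [seriesConj]

theorem seriesConj_seriesConj (φ : ℍ⟦X⟧) : seriesConj (seriesConj φ) = φ := by
  ext1 n; simp

theorem seriesConj_mul (φ ψ : ℍ⟦X⟧) : seriesConj (φ * ψ) = seriesConj ψ * seriesConj φ := by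
  ext1 n
  simp only [coeff_seriesConj, coeff_mul, star_sum, star_mul]
  rw [← Finset.Nat.sum_antidiagonal_swap]
  rfl

theorem ConvergesOnBall.seriesConj {φ : ℍ⟦X⟧} (h : ConvergesOnBall φ) :
    ConvergesOnBall (seriesConj φ) := fun r h0 h1 => by
  simpa using h r h0 h1

theorem Represents.regConj {φ : ℍ⟦X⟧} {f : ℍ → ℍ} (hf : Represents φ f) :
    Represents (seriesConj φ) (SliceRegular.regConj f) := by
  refine ⟨hf.1.seriesConj, fun q _ => ?_⟩
  rw [SliceRegular.regConj, evalAt, hf.coeffs_eq]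
  simp

theorem Represents.symmetrization {φ : ℍ⟦X⟧} {f : ℍ → ℍ} (hf : Represents φ f) :
    Represents (φ * seriesConj φ) (SliceRegular.symmetrization f) := hf.regMul hf.regConj

/-- The symmetrization has real coefficients. -/
theorem coeff_mul_seriesConj (φ : ℍ⟦X⟧) (n : ℕ) :
    coeff n (φ * seriesConj φ) = ((coeff n (φ * seriesConj φ)).re : ℍ) := by
  rw [← Quaternion.star_eq_self, ← coeff_seriesConj, seriesConj_mul, seriesConj_seriesConj]

theorem commute_mul_seriesConj (φ ψ : ℍ⟦X⟧) : Commute (φ * seriesConj φ) ψ := by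
  ext1 n
  rw [coeff_mul, coeff_mul, ← Finset.Nat.sum_antidiagonal_swap]
  refine Finset.sum_congr rfl fun p _ => ?_
  simp only [Prod.fst_swap, Prod.snd_swap]
  rw [coeff_mul_seriesConj]
  exact Quaternion.coe_commutes _ _

/-- A series commutes with its conjugate: cancel `φ` in `φ (φ φᶜ) = (φ φᶜ) φ`. -/
theorem seriesConj_mul_self (φ : ℍ⟦X⟧) : seriesConj φ * φ = φ * seriesConj φ := by
  by_cases h : φ = 0
  · simp [h]
  · refine mul_left_cancel₀ h ?_
    rw [← mul_assoc, (commute_mul_seriesConj φ φ).eq]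

theorem commute_evalAt_mul_seriesConj (φ : ℍ⟦X⟧) (q : ℍ) :
    Commute q (evalAt (φ * seriesConj φ) q) := by
  refine Commute.tsum_right _ fun n => ?_
  rw [coeff_mul_seriesConj]
  exact (Commute.self_pow q n).mul_right (Quaternion.coe_commute _ _).symm

/-- The symmetrization acts by pointwise multiplication. -/
theorem evalAt_mul_seriesConj_mul {φ ψ : ℍ⟦X⟧} (hφ : ConvergesOnBall φ) (hψ : ConvergesOnBall ψ)
    {q : ℍ} (hq : ‖q‖ < 1) :
    evalAt (φ * seriesConj φ * ψ) q = evalAt (φ * seriesConj φ) q * evalAt ψ q :=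
  evalAt_mul_of_commute (hφ.mul hφ.seriesConj) hψ hq (commute_evalAt_mul_seriesConj φ q)

/-- The left quotient of `φ * η` by `φ` is `η`. -/
theorem Represents.leftQuotient_eq {φ η : ℍ⟦X⟧} {F f : ℍ → ℍ} (hF : Represents φ F)
    (hη : ConvergesOnBall η) (hf : Represents (φ * η) f) {q : ℍ} (hq : ‖q‖ < 1)
    (h : SliceRegular.symmetrization F q ≠ 0) : leftQuotient F f q = evalAt η q := by
  rw [leftQuotient, (hF.regConj.regMul hf).2 q hq, ← mul_assoc, seriesConj_mul_self,
    evalAt_mul_seriesConj_mul hF.1 hη hq, ← hF.symmetrization.2 q hq, inv_mul_cancel_left₀ h]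

theorem convergesOnBall_one : ConvergesOnBall 1 := fun r _ _ =>
  summable_of_ne_finset_zero (s := {0}) fun n hn => by
    simp [coeff_one, Finset.notMem_singleton.1 hn]

@[simp]
theorem evalAt_one (q : ℍ) : evalAt 1 q = 1 := by
  rw [evalAt, tsum_eq_single 0 fun n hn => by simp [coeff_one, hn]]
  simp

theorem represents_one : Represents 1 (fun _ => 1) := ⟨convergesOnBall_one, by simp⟩

/-- If `φ` is invertible among the convergent series, then its symmetrization has no zeros and the
regular reciprocal is the inverse series. -/
theorem Represents.regRecip {φ ψ : ℍ⟦X⟧} {F : ℍ → ℍ} (hF : Represents φ F)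
    (hψ : ConvergesOnBall ψ) (h1 : φ * ψ = 1) : Represents ψ (SliceRegular.regRecip F) := by
  refine ⟨hψ, fun q hq => ?_⟩
  refine hF.leftQuotient_eq hψ (h1 ▸ represents_one) hq ?_
  rw [hF.symmetrization.2 q hq]
  have h2 : φ * seriesConj φ * (ψ * seriesConj ψ) = 1 := by
    have h3 : ψ * φ = 1 := mul_left_cancel₀ (left_ne_zero_of_mul_eq_one h1) (by
      rw [← mul_assoc, h1, one_mul, mul_one])
    rw [← seriesConj_mul_self, mul_assoc, ← mul_assoc φ, h1, one_mul, ← seriesConj_mul, h3]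
    ext1 n
    by_cases hn : n = 0 <;> simp [coeff_one, hn]
  have h3 := evalAt_mul_seriesConj_mul hF.1 (hψ.mul hψ.seriesConj) hq
  rw [h2, evalAt_one] at h3
  exact left_ne_zero_of_mul_eq_one h3.symm

/-! ### Slices as complex Banach spaces -/

theorem norm_of_mem_imagUnits {I : ℍ} (hI : I ∈ imagUnits) : ‖I‖ = 1 := by
  have h : ‖I‖ ^ 2 = 1 := by rw [← norm_pow, show I ^ 2 = -1 from hI, norm_neg, norm_one]
  exact (pow_eq_one_iff_of_nonneg (norm_nonneg I) two_ne_zero).1 h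

theorem star_of_mem_imagUnits {I : ℍ} (hI : I ∈ imagUnits) : star I = -I := by
  have h1 : I * star I = 1 := by
    rw [Quaternion.self_mul_star, Quaternion.normSq_eq_norm_mul_self, norm_of_mem_imagUnits hI]
    simp
  have h2 : I * -I = 1 := by rw [mul_neg, ← pow_two, show I ^ 2 = -1 from hI, neg_neg]
  have h0 : I ≠ 0 := left_ne_zero_of_mul_eq_one h1
  exact mul_left_cancel₀ h0 (h1.trans h2.symm)

/-- The embedding `x + iy ↦ x + Iy` of the complex numbers onto the slice of `I`. -/
noncomputable def sliceEmb (I : imagUnits) : ℂ →ₐ[ℝ] ℍ :=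
  Complex.liftAux (I : ℍ) (by rw [← pow_two]; exact I.2)

theorem sliceEmb_apply (I : imagUnits) (z : ℂ) : sliceEmb I z = slicePoint I z.re z.im := by
  rw [sliceEmb, Complex.liftAux_apply, slicePoint, Quaternion.mul_coe_eq_smul]
  rfl

theorem star_sliceEmb (I : imagUnits) (z : ℂ) :
    star (sliceEmb I z) = sliceEmb I ((starRingEnd ℂ) z) := by
  simp [sliceEmb_apply, slicePoint, star_of_mem_imagUnits I.2, Quaternion.coe_commutes]

theorem norm_sliceEmb (I : imagUnits) (z : ℂ) : ‖sliceEmb I z‖ = ‖z‖ := by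
  have h : ((Quaternion.normSq (sliceEmb I z) : ℝ) : ℍ) = ((Complex.normSq z : ℝ) : ℍ) := by
    rw [← Quaternion.self_mul_star, star_sliceEmb, ← map_mul, Complex.mul_conj]
    exact (sliceEmb I).commutes _
  have h2 := Quaternion.coe_injective h
  rw [Quaternion.normSq_eq_norm_mul_self, Complex.normSq_eq_norm_sq, ← pow_two] at h2
  exact (pow_left_inj₀ (norm_nonneg _) (norm_nonneg _) two_ne_zero).1 h2

theorem exists_sliceEmb_eq (q : ℍ) :
    sliceEmb ⟨sliceUnit q, sliceUnit_mem q⟩ ⟨q.re, ‖q.im‖⟩ = q := by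
  rw [sliceEmb_apply]; exact slicePoint_sliceUnit q

/-- The quaternions, regarded as a complex vector space in which the imaginary unit acts by left
multiplication by `I`. -/
def SliceModule (_ : imagUnits) : Type := ℍ

noncomputable instance (I : imagUnits) : NormedAddCommGroup (SliceModule I) :=
  inferInstanceAs (NormedAddCommGroup ℍ)

instance (I : imagUnits) : CompleteSpace (SliceModule I) := inferInstanceAs (CompleteSpace ℍ)

noncomputable instance (I : imagUnits) : Module ℂ (SliceModule I) :=
  Module.compHom ℍ (sliceEmb I : ℂ →+* ℍ)

/-- The identity map, forgetting the complex structure of `SliceModule I`. -/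
noncomputable def SliceModule.equiv (I : imagUnits) : SliceModule I ≃+ ℍ := AddEquiv.refl ℍ

theorem SliceModule.continuous_equiv (I : imagUnits) : Continuous (SliceModule.equiv I) :=
  continuous_id (X := ℍ)

theorem SliceModule.equiv_smul (I : imagUnits) (z : ℂ) (v : SliceModule I) :
    SliceModule.equiv I (z • v) = sliceEmb I z * SliceModule.equiv I v := rfl

theorem SliceModule.norm_equiv (I : imagUnits) (v : SliceModule I) :
    ‖SliceModule.equiv I v‖ = ‖v‖ := rfl

theorem SliceModule.norm_equiv_symm (I : imagUnits) (v : ℍ) :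
    ‖(SliceModule.equiv I).symm v‖ = ‖v‖ := rfl

noncomputable instance (I : imagUnits) : NormedSpace ℂ (SliceModule I) where
  norm_smul_le z v := by
    rw [← SliceModule.norm_equiv, ← SliceModule.norm_equiv, SliceModule.equiv_smul, norm_mul,
      norm_sliceEmb]

instance (I : imagUnits) : StrictConvexSpace ℝ (SliceModule I) :=
  StrictConvexSpace.of_norm_add_ne_two fun x y hx hy hxy h =>
    hxy ((SliceModule.equiv I).injective (eq_of_norm_eq_of_norm_add_eq (hx.trans hy.symm) (by
      rw [← map_add, SliceModule.norm_equiv, SliceModule.norm_equiv, SliceModule.norm_equiv, h, hx,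
        hy]
      norm_num)))

/-- The restriction of `f` to the slice of `I`. -/
noncomputable def sliceFun (I : imagUnits) (f : ℍ → ℍ) (z : ℂ) : SliceModule I :=
  (SliceModule.equiv I).symm (f (sliceEmb I z))

/-- The real-linear map `w ↦ w d`, with `w` running through the slice of `I`. -/
noncomputable def sliceDeriv (I : imagUnits) (d : ℍ) : ℂ →L[ℝ] ℍ :=
  LinearMap.toContinuousLinearMap
    ((LinearMap.mulRight ℝ d).comp (sliceEmb I).toLinearMap)

theorem sliceDeriv_apply (I : imagUnits) (d : ℍ) (w : ℂ) : sliceDeriv I d w = sliceEmb I w * d :=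
  rfl

theorem hasDerivAt_sliceFun_iff {I : imagUnits} {f : ℍ → ℍ} {d : ℍ} {z : ℂ} :
    HasDerivAt (sliceFun I f) ((SliceModule.equiv I).symm d) z ↔
      HasFDerivAt (𝕜 := ℝ) (fun w => f (sliceEmb I w)) (sliceDeriv I d) z := by
  refine hasDerivAt_iff_isLittleO.trans (Iff.trans ?_ hasFDerivAt_iff_isLittleO.symm)
  rfl

theorem hasDerivAt_sliceFun_iff_prod {I : imagUnits} {f : ℍ → ℍ} {d : ℍ} {z : ℂ} :
    HasDerivAt (sliceFun I f) ((SliceModule.equiv I).symm d) z ↔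
      HasFDerivAt (𝕜 := ℝ) (fun p : ℝ × ℝ => f (slicePoint I p.1 p.2))
        ((sliceDeriv I d).comp (Complex.equivRealProdCLM.symm : ℝ × ℝ →L[ℝ] ℂ)) (z.re, z.im) := by
  rw [hasDerivAt_sliceFun_iff]
  have h := Complex.equivRealProdCLM.symm.comp_right_hasFDerivAt_iff
    (f := fun w => f (sliceEmb I w)) (f' := sliceDeriv I d) (x := (z.re, z.im))
  have h0 : Complex.equivRealProdCLM.symm (z.re, z.im) = z := by
    apply Complex.ext <;> simp
  rw [h0] at h
  rw [← h]
  have : (fun w => f (sliceEmb I w)) ∘ Complex.equivRealProdCLM.symm =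
      fun p : ℝ × ℝ => f (slicePoint I p.1 p.2) := by
    funext p
    simp [sliceEmb_apply]
  rw [this]

theorem partialX_eq {f : ℍ → ℍ} {I : ℍ} {x y : ℝ} {L : ℝ × ℝ →L[ℝ] ℍ}
    (h : HasFDerivAt (fun p : ℝ × ℝ => f (slicePoint I p.1 p.2)) L (x, y)) :
    partialX f I x y = L (1, 0) :=
  (HasFDerivAt.comp_hasDerivAt (f := fun t : ℝ => (t, y)) x h
    ((hasDerivAt_id x).prodMk (hasDerivAt_const x y))).deriv

theorem partialY_eq {f : ℍ → ℍ} {I : ℍ} {x y : ℝ} {L : ℝ × ℝ →L[ℝ] ℍ}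
    (h : HasFDerivAt (fun p : ℝ × ℝ => f (slicePoint I p.1 p.2)) L (x, y)) :
    partialY f I x y = L (0, 1) :=
  (HasFDerivAt.comp_hasDerivAt (f := fun t : ℝ => (x, t)) y h
    ((hasDerivAt_const y x).prodMk (hasDerivAt_id y))).deriv

theorem partialX_of_hasDerivAt {f : ℍ → ℍ} {I : imagUnits} {d : ℍ} {z : ℂ}
    (h : HasDerivAt (sliceFun I f) ((SliceModule.equiv I).symm d) z) :
    partialX f I z.re z.im = d := by
  rw [partialX_eq (hasDerivAt_sliceFun_iff_prod.1 h)]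
  simp [sliceDeriv_apply, sliceEmb_apply, slicePoint]

theorem partialY_of_hasDerivAt {f : ℍ → ℍ} {I : imagUnits} {d : ℍ} {z : ℂ}
    (h : HasDerivAt (sliceFun I f) ((SliceModule.equiv I).symm d) z) :
    partialY f I z.re z.im = I * d := by
  rw [partialY_eq (hasDerivAt_sliceFun_iff_prod.1 h)]
  simp [sliceDeriv_apply, sliceEmb_apply, slicePoint]

theorem mul_mul_of_mem_imagUnits {I : ℍ} (hI : I ∈ imagUnits) (d : ℍ) : I * (I * d) = -d := by
  rw [← mul_assoc, ← pow_two, show I ^ 2 = -1 from hI, neg_one_mul]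

theorem cullenDeriv_of_hasDerivAt {f : ℍ → ℍ} {q d : ℍ}
    (h : HasDerivAt (sliceFun ⟨sliceUnit q, sliceUnit_mem q⟩ f)
      ((SliceModule.equiv _).symm d) ⟨q.re, ‖q.im‖⟩) :
    cullenDeriv f q = d := by
  have hx := partialX_of_hasDerivAt h
  have hy := partialY_of_hasDerivAt h
  simp only at hx hy
  rw [cullenDeriv, hx, hy, mul_mul_of_mem_imagUnits (sliceUnit_mem q), sub_neg_eq_add,
    ← two_smul ℝ d, smul_smul]
  norm_num

/-- Slice regularity is holomorphy of every slice for the corresponding complex structure. -/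
theorem isRegularOn_unitBall_iff {f : ℍ → ℍ} :
    IsRegularOn f unitBall ↔ ∀ I, DifferentiableOn ℂ (sliceFun I f) (Metric.ball 0 1) := by
  have hmem : ∀ (I : imagUnits) (z : ℂ), slicePoint I z.re z.im ∈ unitBall ↔ ‖z‖ < 1 := by
    intro I z
    rw [← sliceEmb_apply, ← norm_sliceEmb I]; rfl
  constructor
  · intro h I z hz
    obtain ⟨hd, hcr⟩ := h I I.2 z.re z.im ((hmem I z).2 (by simpa using hz))
    obtain ⟨L, hL⟩ := hd
    rw [partialX_eq hL, partialY_eq hL, smul_eq_zero_iff_right (by norm_num)] at hcr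
    refine DifferentiableAt.differentiableWithinAt
      (hasDerivAt_sliceFun_iff_prod (d := L (1, 0)).2 ?_).differentiableAt
    convert hL using 1
    -- The Cauchy-Riemann equation determines the derivative in the direction of `I`.
    have hI : L (0, 1) = I * L (1, 0) := by
      rw [eq_neg_of_add_eq_zero_left hcr, mul_neg, mul_mul_of_mem_imagUnits I.2, neg_neg]
    refine ContinuousLinearMap.ext fun p => ?_
    have hp : p = p.1 • ((1, 0) : ℝ × ℝ) + p.2 • ((0, 1) : ℝ × ℝ) := by ext <;> simp
    conv_rhs => rw [hp]
    rw [map_add, map_smul, map_smul, hI]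
    simp [sliceDeriv_apply, sliceEmb_apply, slicePoint, add_mul, Quaternion.coe_mul_eq_smul,
      Quaternion.mul_coe_eq_smul]
  · intro h I hI x y hxy
    have hz : ‖(⟨x, y⟩ : ℂ)‖ < 1 := (hmem ⟨I, hI⟩ ⟨x, y⟩).1 hxy
    have hd := ((h ⟨I, hI⟩).differentiableAt
      (Metric.isOpen_ball.mem_nhds (mem_ball_zero_iff.2 hz))).hasDerivAt
    rw [← (SliceModule.equiv ⟨I, hI⟩).symm_apply_apply (deriv _ _)] at hd
    refine ⟨(hasDerivAt_sliceFun_iff_prod.1 hd).differentiableAt, ?_⟩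
    have hx := partialX_of_hasDerivAt hd
    have hy := partialY_of_hasDerivAt hd
    simp only at hx hy
    rw [hx, hy, mul_mul_of_mem_imagUnits hI, add_neg_cancel, smul_zero]

/-! ### Regular functions are the sums of convergent power series -/

theorem ConvergesOnBall.differentiableOn {φ : ℍ⟦X⟧} (h : ConvergesOnBall φ) (I : imagUnits) :
    DifferentiableOn ℂ (sliceFun I (evalAt φ)) (Metric.ball 0 1) := by
  intro z hz
  obtain ⟨r, hzr, hr⟩ := exists_between (mem_ball_zero_iff.1 hz)
  have hr0 : 0 ≤ r := (norm_nonneg z).trans hzr.le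
  have key := Complex.differentiableOn_tsum_of_summable_norm
    (F := fun n (w : ℂ) => w ^ n • (SliceModule.equiv I).symm (coeff n φ))
    (h r hr0 hr) (fun n => by fun_prop) (Metric.isOpen_ball (x := (0 : ℂ)) (ε := r))
    (fun n w hw => by
      rw [norm_smul, norm_pow, mul_comm, SliceModule.norm_equiv_symm]
      gcongr
      exact (mem_ball_zero_iff.1 hw).le)
  have heq : sliceFun I (evalAt φ) =
      fun w : ℂ => ∑' n, w ^ n • (SliceModule.equiv I).symm (coeff n φ) := by
    funext w
    have hw : ∀ n, w ^ n • (SliceModule.equiv I).symm (coeff n φ) =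
        (SliceModule.equiv I).symm (sliceEmb I w ^ n * coeff n φ) := fun n => by
      rw [← map_pow]; rfl
    simp only [hw]
    rfl
  rw [heq]
  exact (key.differentiableAt (Metric.isOpen_ball.mem_nhds
    (mem_ball_zero_iff.2 hzr))).differentiableWithinAt

theorem Represents.isRegularOn {φ : ℍ⟦X⟧} {f : ℍ → ℍ} (h : Represents φ f) :
    IsRegularOn f unitBall := by
  refine isRegularOn_unitBall_iff.2 fun I => (h.1.differentiableOn I).congr fun z hz => ?_
  exact h.2 _ (by rw [norm_sliceEmb]; exact mem_ball_zero_iff.1 hz)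

/-- A regular function has an expansion. The Taylor coefficients on the various slices agree,
because all slices contain the real axis. -/
theorem IsRegularOn.exists_represents {f : ℍ → ℍ} (hf : IsRegularOn f unitBall) :
    ∃ φ, Represents φ f := by
  rw [isRegularOn_unitBall_iff] at hf
  let a : imagUnits → ℕ → ℍ := fun I n =>
    sliceEmb I ((n.factorial : ℂ)⁻¹) * SliceModule.equiv I (iteratedDeriv n (sliceFun I f) 0)
  have ha : ∀ (I : imagUnits) (z : ℂ), ‖z‖ < 1 →
      HasSum (fun n => sliceEmb I z ^ n * a I n) (f (sliceEmb I z)) := by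
    intro I z hz
    have h := (Complex.hasSum_taylorSeries_on_ball (hf I) (mem_ball_zero_iff.2 hz)).map
      (SliceModule.equiv I) (SliceModule.continuous_equiv I)
    convert h using 1
    · funext n
      simp only [a, sub_zero, Function.comp_apply, SliceModule.equiv_smul]
      rw [← map_pow, ← mul_assoc, ← mul_assoc, ← map_mul, ← map_mul, mul_comm]
    · rfl
  have hreal : ∀ (I : imagUnits) (x : ℝ), |x| < 1 →
      HasSum (fun n => x ^ n • a I n) (f (x : ℍ)) := by
    intro I x hx
    have h := ha I x (by rwa [Complex.norm_real])
    have hx : sliceEmb I (x : ℂ) = (x : ℍ) := (sliceEmb I).commutes x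
    rw [hx] at h
    convert h using 2 with n
    rw [← Quaternion.coe_pow, Quaternion.coe_mul_eq_smul]
  let I₀ : imagUnits := ⟨sliceUnit 0, sliceUnit_mem 0⟩
  refine ⟨_, HasExpansion.represents (a := a I₀) fun q hq => ?_⟩
  let I : imagUnits := ⟨sliceUnit q, sliceUnit_mem q⟩
  have hI : sliceEmb I ⟨q.re, ‖q.im‖⟩ = q := exists_sliceEmb_eq q
  have h := ha I ⟨q.re, ‖q.im‖⟩ (by rw [← norm_sliceEmb I, hI]; exact hq)
  rwa [hI, coeff_eq_of_hasSum_real (f := fun x : ℝ => f (x : ℍ)) (hreal I) (hreal I₀)] at h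

/-! ### Existence and uniqueness of quotients -/

theorem Represents.isQuotientOnBall {φ η : ℍ⟦X⟧} {F f : ℍ → ℍ} (hF : Represents φ F)
    (hη : ConvergesOnBall η) (hf : Represents (φ * η) f) : IsQuotientOnBall F f (evalAt η) :=
  ⟨Represents.isRegularOn ⟨hη, fun _ _ => rfl⟩,
    fun _ hq h => (hF.leftQuotient_eq hη hf hq h).symm⟩

/-- Uniqueness of the regular extension of a quotient. Both candidates have the same product with
the symmetrization, and the ring of power series over `ℍ` has no zero divisors. -/
theorem IsQuotientOnBall.represents {φ η : ℍ⟦X⟧} {F f h : ℍ → ℍ} (hh : IsQuotientOnBall F f h)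
    (hF : Represents φ F) (hφ : φ ≠ 0) (hη : ConvergesOnBall η) (hf : Represents (φ * η) f) :
    Represents η h := by
  obtain ⟨ψ, hψ⟩ := hh.1.exists_represents
  have hs : φ * seriesConj φ ≠ 0 := by
    refine mul_ne_zero hφ fun h0 => hφ ?_
    rw [← seriesConj_seriesConj φ, h0]
    ext1 n; simp
  have key : φ * seriesConj φ * ψ = φ * seriesConj φ * η := by
    refine Represents.unique (f := evalAt (φ * seriesConj φ * ψ))
      ⟨(hF.1.mul hF.1.seriesConj).mul hψ.1, fun _ _ => rfl⟩
      ⟨(hF.1.mul hF.1.seriesConj).mul hη, fun q hq => ?_⟩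
    rw [evalAt_mul_seriesConj_mul hF.1 hψ.1 hq, evalAt_mul_seriesConj_mul hF.1 hη hq]
    by_cases h0 : SliceRegular.symmetrization F q = 0
    · rw [← hF.symmetrization.2 q hq, h0, zero_mul, zero_mul]
    · rw [← hψ.2 q hq, hh.2 q hq h0, hF.leftQuotient_eq hη hf hq h0]
  rwa [mul_left_cancel₀ hs key] at hψ

/-! ### Linear factors and the Möbius transformation -/

theorem represents_linear (a b : ℍ) :
    Represents (C a + C b * X) (fun q => a + q * b) := by
  have h0 : ∀ n, n ∉ Finset.range 2 → coeff n (C a + C b * X) = 0 := fun n hn => by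
    have h2 : 2 ≤ n := not_lt.1 fun h => hn (Finset.mem_range.2 h)
    have h3 : n ≠ 0 := by omega
    have h4 : n ≠ 1 := by omega
    simp [coeff_C, coeff_X, h3, h4]
  refine ⟨fun r _ _ => summable_of_ne_finset_zero (s := Finset.range 2) fun n hn => by
    simp [h0 n hn], fun q _ => ?_⟩
  rw [evalAt, tsum_eq_sum (s := Finset.range 2) fun n hn => by rw [h0 n hn, mul_zero]]
  simp [Finset.sum_range_succ, coeff_C, coeff_X]

theorem represents_C (a : ℍ) : Represents (C a) (fun _ => a) := by
  simpa using represents_linear a 0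

theorem evalAt_mul_C {φ : ℍ⟦X⟧} (hφ : ConvergesOnBall φ) {q : ℍ} (hq : ‖q‖ < 1) (u : ℍ) :
    evalAt (φ * C u) q = evalAt φ q * u := by
  rw [evalAt_mul_eq_tsum hφ (represents_C u).1 hq, tsum_eq_single 0 fun n hn => by
    rw [coeff_C, if_neg hn, mul_zero]]
  simp

/-- The series of `q - q₀`. -/
noncomputable def linSeries (q₀ : ℍ) : ℍ⟦X⟧ := X - C q₀

/-- The series of `1 - q q̄₀`. -/
noncomputable def denomSeries (q₀ : ℍ) : ℍ⟦X⟧ := 1 - C (star q₀) * X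

/-- The series `∑ qⁿ q̄₀ⁿ` of the regular reciprocal of `1 - q q̄₀`. -/
noncomputable def recipSeries (q₀ : ℍ) : ℍ⟦X⟧ := PowerSeries.mk fun n => star q₀ ^ n

theorem represents_linSeries (q₀ : ℍ) : Represents (linSeries q₀) (fun q => q - q₀) := by
  convert represents_linear (-q₀) 1 using 1
  · rw [linSeries, map_neg, map_one, one_mul, sub_eq_neg_add]
  · funext q; rw [mul_one, sub_eq_neg_add]

theorem represents_denomSeries (q₀ : ℍ) : Represents (denomSeries q₀) (moebiusDenom q₀) := by
  convert represents_linear 1 (-star q₀) using 1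
  · rw [denomSeries, map_neg, map_one, neg_mul, sub_eq_add_neg]
  · funext q; rw [moebiusDenom, mul_neg, sub_eq_add_neg]

theorem convergesOnBall_recipSeries {q₀ : ℍ} (h : ‖q₀‖ < 1) :
    ConvergesOnBall (recipSeries q₀) := fun r h0 h1 => by
  have : ‖q₀‖ * r < 1 := mul_lt_one_of_nonneg_of_lt_one_left (norm_nonneg _) h h1.le
  refine (summable_geometric_of_lt_one (by positivity) this).congr fun n => ?_
  simp [recipSeries, mul_pow]

theorem denomSeries_mul_recipSeries (q₀ : ℍ) : denomSeries q₀ * recipSeries q₀ = 1 := by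
  ext1 n
  rw [denomSeries, sub_mul, one_mul, mul_assoc, map_sub, coeff_C_mul]
  cases n with
  | zero => simp [recipSeries]
  | succ n => simp [recipSeries, coeff_succ_X_mul, coeff_one, pow_succ']

theorem recipSeries_mul_denomSeries (q₀ : ℍ) : recipSeries q₀ * denomSeries q₀ = 1 := by
  have h := denomSeries_mul_recipSeries q₀
  refine mul_left_cancel₀ (left_ne_zero_of_mul_eq_one h) ?_
  rw [← mul_assoc, h, one_mul, mul_one]

theorem commute_denomSeries_linSeries (q₀ : ℍ) : Commute (denomSeries q₀) (linSeries q₀) := by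
  have h1 : Commute (C (star q₀)) (C q₀) := by
    rw [commute_iff_eq, ← map_mul, ← map_mul, star_comm_self']
  have hX : ∀ φ : ℍ⟦X⟧, Commute X φ := fun φ => (commute_X φ).symm
  exact (Commute.one_left _).sub_left
    (((hX _).symm.sub_right h1).mul_left ((hX _).sub_right (hX _)))

theorem represents_recipSeries {q₀ : ℍ} (h : ‖q₀‖ < 1) :
    Represents (recipSeries q₀) (regRecip (moebiusDenom q₀)) :=
  (represents_denomSeries q₀).regRecip (convergesOnBall_recipSeries h)
    (denomSeries_mul_recipSeries q₀)

theorem represents_moebius {q₀ : ℍ} (h : ‖q₀‖ < 1) :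
    Represents (linSeries q₀ * recipSeries q₀) (moebius q₀) :=
  (represents_linSeries q₀).regMul (represents_recipSeries h)

theorem linSeries_ne_zero (q₀ : ℍ) : linSeries q₀ ≠ 0 := fun h => by
  have := congrArg (coeff 1) h
  simp [linSeries] at this

theorem recipSeries_ne_zero (q₀ : ℍ) : recipSeries q₀ ≠ 0 :=
  right_ne_zero_of_mul_eq_one (denomSeries_mul_recipSeries q₀)

theorem evalAt_recipSeries_ne_zero {q₀ : ℍ} (h : ‖q₀‖ < 1) {q : ℍ} (hq : ‖q‖ < 1) :
    evalAt (recipSeries q₀) q ≠ 0 := fun h0 => by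
  have := evalAt_mul_of_eq_zero (convergesOnBall_recipSeries h) (represents_denomSeries q₀).1 hq h0
  rw [recipSeries_mul_denomSeries, evalAt_one] at this
  exact one_ne_zero this

/-- A zero of `𝓜_{q₀}` is a zero of its product with `1 - q q̄₀`, which is `q - q₀`. -/
theorem moebius_ne_zero {q₀ : ℍ} (h : ‖q₀‖ < 1) {q : ℍ} (hq : ‖q‖ < 1) (hne : q ≠ q₀) :
    moebius q₀ q ≠ 0 := fun h0 => by
  rw [(represents_moebius h).2 q hq] at h0
  have := evalAt_mul_of_eq_zero (represents_moebius h).1 (represents_denomSeries q₀).1 hq h0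
  rw [mul_assoc, recipSeries_mul_denomSeries, mul_one, ← (represents_linSeries q₀).2 q hq] at this
  exact hne (sub_eq_zero.1 this)

/-- On the slice of `q₀` the reciprocal of `1 - q q̄₀` is the pointwise one. -/
theorem evalAt_recipSeries_of_commute {q₀ : ℍ} (h : ‖q₀‖ < 1) {q : ℍ} (hq : ‖q‖ < 1)
    (hc : Commute q (star q₀)) : evalAt (recipSeries q₀) q = (1 - q * star q₀)⁻¹ := by
  have hD : evalAt (denomSeries q₀) q = 1 - q * star q₀ :=
    ((represents_denomSeries q₀).2 q hq).symm
  have hcomm : Commute q (evalAt (denomSeries q₀) q) := by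
    rw [hD]
    exact (Commute.one_right q).sub_right ((Commute.refl q).mul_right hc)
  have key := evalAt_mul_of_commute (represents_denomSeries q₀).1 (convergesOnBall_recipSeries h)
    hq hcomm
  rw [denomSeries_mul_recipSeries, evalAt_one, hD] at key
  exact eq_inv_of_mul_eq_one_right key.symm

/-! ### Division by a linear factor -/

/-- The left quotient by `q - q₀` of a series with coefficients `aₙ` and value zero at `q₀`. Its
coefficients `bₙ = ∑ q₀ᵏ a_{n+1+k}` solve the recursion `bₙ = aₙ₊₁ + q₀ bₙ₊₁`. -/
noncomputable def divLinear (q₀ : ℍ) (φ : ℍ⟦X⟧) : ℍ⟦X⟧ :=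
  PowerSeries.mk fun n => ∑' k, q₀ ^ k * coeff (n + 1 + k) φ

theorem coeff_divLinear (q₀ : ℍ) (φ : ℍ⟦X⟧) (n : ℕ) :
    coeff n (divLinear q₀ φ) = ∑' k, q₀ ^ k * coeff (n + 1 + k) φ := by simp [divLinear]

theorem norm_divLinear_term_le {φ : ℍ⟦X⟧} {q₀ : ℍ} {ρ B : ℝ} (hρ : 0 < ρ)
    (hB : ∀ n, ‖coeff n φ‖ * ρ ^ n ≤ B) (n k : ℕ) :
    ‖q₀ ^ k * coeff (n + k) φ‖ * ρ ^ n ≤ B * (‖q₀‖ / ρ) ^ k := by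
  calc ‖q₀ ^ k * coeff (n + k) φ‖ * ρ ^ n
      = (‖coeff (n + k) φ‖ * ρ ^ (n + k)) * (‖q₀‖ / ρ) ^ k := by
        rw [norm_mul, norm_pow, pow_add, div_pow]; field_simp
    _ ≤ B * (‖q₀‖ / ρ) ^ k := by gcongr; exact hB _

theorem summable_divLinear_norm {φ : ℍ⟦X⟧} {q₀ : ℍ} (hφ : ConvergesOnBall φ) (h : ‖q₀‖ < 1)
    (n : ℕ) : Summable fun k => ‖q₀ ^ k * coeff (n + k) φ‖ := by
  obtain ⟨ρ, h1, h2⟩ := exists_between h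
  have hρ : 0 < ρ := (norm_nonneg _).trans_lt h1
  obtain ⟨B, hB⟩ := hφ.bound hρ.le h2
  refine Summable.of_nonneg_of_le (fun k => norm_nonneg _) (fun k => ?_)
    (((summable_geometric_of_lt_one (by positivity) ((div_lt_one hρ).2 h1)).mul_left B).mul_right
      (ρ ^ n)⁻¹)
  rw [← div_eq_mul_inv, le_div_iff₀ (by positivity)]
  exact norm_divLinear_term_le hρ hB n k

theorem ConvergesOnBall.divLinear {φ : ℍ⟦X⟧} {q₀ : ℍ} (hφ : ConvergesOnBall φ) (h : ‖q₀‖ < 1) :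
    ConvergesOnBall (divLinear q₀ φ) := by
  refine convergesOnBall_of_bound fun ρ₀ h0 h1 => ?_
  obtain ⟨ρ, h2, h3⟩ := exists_between (max_lt h1 h)
  have hρ0 : ρ₀ < ρ := (le_max_left _ _).trans_lt h2
  have hq : ‖q₀‖ < ρ := (le_max_right _ _).trans_lt h2
  have hρ : 0 < ρ := h0.trans hρ0
  obtain ⟨B, hB⟩ := hφ.bound hρ.le h3
  have hg := (summable_geometric_of_lt_one (r := ‖q₀‖ / ρ) (by positivity)
    ((div_lt_one hρ).2 hq)).mul_left B
  refine ⟨ρ, (∑' k, B * (‖q₀‖ / ρ) ^ k) / ρ, hρ0.le, fun n => ?_⟩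
  rw [le_div_iff₀ hρ, mul_assoc, ← pow_succ, coeff_divLinear]
  have hs := summable_divLinear_norm hφ h (n + 1)
  calc _ ≤ (∑' k, ‖q₀ ^ k * coeff (n + 1 + k) φ‖) * ρ ^ (n + 1) := by
        gcongr; exact norm_tsum_le_tsum_norm hs
    _ = ∑' k, ‖q₀ ^ k * coeff (n + 1 + k) φ‖ * ρ ^ (n + 1) := tsum_mul_right.symm
    _ ≤ _ := (hs.mul_right _).tsum_le_tsum (norm_divLinear_term_le hρ hB (n + 1)) hg

/-- A convergent series with value zero at `q₀` has the left factor `q - q₀`. -/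
theorem linSeries_mul_divLinear {φ : ℍ⟦X⟧} {q₀ : ℍ} (hφ : ConvergesOnBall φ) (h : ‖q₀‖ < 1)
    (h0 : evalAt φ q₀ = 0) : linSeries q₀ * divLinear q₀ φ = φ := by
  have hrec : ∀ n, ∑' k, q₀ ^ k * coeff (n + k) φ =
      coeff n φ + q₀ * ∑' k, q₀ ^ k * coeff (n + 1 + k) φ := fun n => by
    rw [(summable_divLinear_norm hφ h n).of_norm.tsum_eq_zero_add, ← tsum_mul_left]
    simp [pow_succ', mul_assoc, add_assoc, add_comm 1]
  ext1 n
  rw [linSeries, sub_mul, map_sub, coeff_C_mul, coeff_divLinear]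
  cases n with
  | zero =>
    have := hrec 0
    simp only [zero_add] at this ⊢
    rw [← evalAt.eq_def φ q₀, h0] at this
    rw [coeff_zero_X_mul, zero_sub, neg_eq_iff_add_eq_zero, add_comm, ← this]
  | succ n => rw [coeff_succ_X_mul, coeff_divLinear, hrec (n + 1), add_sub_cancel_right]

/-! ### The maximum principle -/

/-- The maximum principle on a slice. -/
theorem ConvergesOnBall.norm_evalAt_le {η : ℍ⟦X⟧} (hη : ConvergesOnBall η) {r B : ℝ} (h1 : r < 1)
    (hB : ∀ w : ℍ, ‖w‖ = r → ‖evalAt η w‖ ≤ B) {q : ℍ} (hq : ‖q‖ < r) : ‖evalAt η q‖ ≤ B := by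
  have hr : r ≠ 0 := ((norm_nonneg q).trans_lt hq).ne'
  let I : imagUnits := ⟨sliceUnit q, sliceUnit_mem q⟩
  have hI : sliceEmb I ⟨q.re, ‖q.im‖⟩ = q := exists_sliceEmb_eq q
  have hd : DiffContOnCl ℂ (sliceFun I (evalAt η)) (Metric.ball 0 r) := by
    refine DifferentiableOn.diffContOnCl ((hη.differentiableOn I).mono ?_)
    rw [closure_ball _ hr]
    exact Metric.closedBall_subset_ball h1
  have key := Complex.norm_le_of_forall_mem_frontier_norm_le Metric.isBounded_ball hd (C := B)
    (fun z hz => ?_) (z := ⟨q.re, ‖q.im‖⟩) (subset_closure ?_)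
  · rwa [sliceFun, SliceModule.norm_equiv_symm, hI] at key
  · rw [frontier_ball _ hr] at hz
    exact hB _ (by rw [norm_sliceEmb]; exact mem_sphere_zero_iff_norm.1 hz)
  · rw [mem_ball_zero_iff, ← norm_sliceEmb I, hI]
    exact hq

/-- The strong maximum principle: a regular function bounded by one whose modulus attains the value
one is constant. On one slice this is the strong maximum principle for a strictly convex complex
Banach space; that slice contains the real axis, which determines the coefficients. -/
theorem ConvergesOnBall.eq_C_of_norm_eq_one {η : ℍ⟦X⟧} (hη : ConvergesOnBall η)
    (hB : ∀ w : ℍ, ‖w‖ < 1 → ‖evalAt η w‖ ≤ 1) {q : ℍ} (hq : ‖q‖ < 1) (h : ‖evalAt η q‖ = 1) :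
    η = C (evalAt η q) := by
  let I : imagUnits := ⟨sliceUnit q, sliceUnit_mem q⟩
  let z : ℂ := ⟨q.re, ‖q.im‖⟩
  have hI : sliceEmb I z = q := exists_sliceEmb_eq q
  have hz : z ∈ Metric.ball (0 : ℂ) 1 := by
    rw [mem_ball_zero_iff, ← norm_sliceEmb I, hI]; exact hq
  have key := Complex.eqOn_of_isPreconnected_of_isMaxOn_norm
    (convex_ball (0 : ℂ) 1).isPreconnected Metric.isOpen_ball (hη.differentiableOn I) hz
    (fun w hw => by
      simp only [Set.mem_ofPred_eq, Function.comp_apply, sliceFun, SliceModule.norm_equiv_symm]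
      rw [hI, h]
      exact hB _ (by rw [norm_sliceEmb]; exact mem_ball_zero_iff.1 hw))
  refine PowerSeries.ext (congrFun (coeff_eq_of_hasSum_real (f := fun x : ℝ => evalAt η x)
    (fun x hx => hη.hasExpansion.hasSum_real hx) fun x hx => ?_))
  have hval : evalAt η (x : ℍ) = evalAt (C (evalAt η q)) (x : ℍ) := by
    rw [← (represents_C _).2 _ (by rwa [Quaternion.norm_coe])]
    have := (SliceModule.equiv I).symm.injective
      (key (mem_ball_zero_iff.2 (show ‖(x : ℂ)‖ < 1 by rwa [Complex.norm_real])))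
    rwa [hI, show sliceEmb I (x : ℂ) = (x : ℍ) from (sliceEmb I).commutes x] at this
  simp only [hval]
  exact (represents_C _).1.hasExpansion.hasSum_real hx

theorem norm_one_sub_mul_star_sq (q q₀ : ℍ) :
    ‖1 - q * star q₀‖ ^ 2 = ‖q - q₀‖ ^ 2 + (1 - ‖q‖ ^ 2) * (1 - ‖q₀‖ ^ 2) := by
  simp only [pow_two, ← Quaternion.normSq_eq_norm_mul_self, Quaternion.normSq_def']
  simp
  ring

/-- The boundary estimate. Every `w` is of the form `(q - q₀)⁻¹ q (q - q₀)` for some `q` of the same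
modulus, and for this `q` the identity `(1 - q q̄₀) * α = (q - q₀) * η` relates `η(w)` to a value
of `α`. -/
theorem norm_sq_evalAt_le {α η : ℍ⟦X⟧} {q₀ : ℍ} (hα : ConvergesOnBall α)
    (hη : ConvergesOnBall η) (hrel : denomSeries q₀ * α = linSeries q₀ * η)
    (hB : ∀ q : ℍ, ‖q‖ < 1 → ‖evalAt α q‖ ≤ 1) {w : ℍ} (h0 : ‖q₀‖ < ‖w‖) (h1 : ‖w‖ < 1) :
    ‖evalAt η w‖ ^ 2 ≤ 1 + (1 - ‖w‖ ^ 2) / (‖w‖ - ‖q₀‖) ^ 2 := by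
  set c : ℍ := w - star q₀ with hc
  have hc0 : c ≠ 0 := fun h => by
    rw [sub_eq_zero.1 h, Quaternion.norm_star] at h0
    exact lt_irrefl _ h0
  set q : ℍ := c⁻¹ * w * c with hq
  have hqn : ‖q‖ = ‖w‖ := norm_inv_mul_mul hc0 w
  have hq1 : ‖q‖ < 1 := hqn ▸ h1
  -- `c (q - q₀) = w² - 2 Re(q₀) w + |q₀|²` commutes with `w`.
  have hP : c * (q - q₀) = w * w - w * (star q₀ + q₀) + star q₀ * q₀ := by
    rw [mul_sub, hq, ← mul_assoc, mul_inv_cancel_left₀ hc0, hc]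
    noncomm_ring
  have hPw : c * (q - q₀) * w = w * (c * (q - q₀)) := by
    have e1 : star q₀ + q₀ = ((2 * q₀.re : ℝ) : ℍ) := Quaternion.star_add_self' q₀
    have e2 : star q₀ * q₀ = ((Quaternion.normSq q₀ : ℝ) : ℍ) := Quaternion.star_mul_self q₀
    rw [hP, e1, e2]
    exact ((((Commute.refl w).mul_right (Commute.refl w)).sub_right
      ((Commute.refl w).mul_right (Quaternion.coe_commute _ w).symm)).add_right
      (Quaternion.coe_commute _ w).symm).eq.symm
  have hcom : (q - q₀) * w = q * (q - q₀) := by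
    refine mul_left_cancel₀ hc0 ?_
    rw [← mul_assoc, hPw, hq]
    simp only [← mul_assoc]
    rw [mul_inv_cancel₀ hc0, one_mul]
  have hle : ‖w‖ - ‖q₀‖ ≤ ‖q - q₀‖ := hqn ▸ norm_sub_norm_le q q₀
  have hN : 0 < ‖q - q₀‖ := (sub_pos.2 h0).trans_le hle
  have hlin : evalAt (linSeries q₀) q = q - q₀ := ((represents_linSeries q₀).2 q hq1).symm
  have hlin0 : evalAt (linSeries q₀) q ≠ 0 := by rw [hlin]; exact norm_pos_iff.1 hN
  have hden : evalAt (denomSeries q₀) q = 1 - q * star q₀ :=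
    ((represents_denomSeries q₀).2 q hq1).symm
  have hw : (q - q₀)⁻¹ * q * (q - q₀) = w := by
    rw [mul_assoc, ← hcom, inv_mul_cancel_left₀ (norm_pos_iff.1 hN)]
  have h3 : ‖q - q₀‖ * ‖evalAt η w‖ ≤ ‖1 - q * star q₀‖ := by
    have e := evalAt_mul (represents_linSeries q₀).1 hη hq1 hlin0
    rw [hlin, hw, ← hrel] at e
    rw [← norm_mul, ← e, ← hden]
    exact norm_evalAt_mul_le (represents_denomSeries q₀).1 hα hB hq1
  have h4 : (‖q - q₀‖ * ‖evalAt η w‖) ^ 2 ≤ ‖q - q₀‖ ^ 2 + (1 - ‖w‖ ^ 2) := by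
    refine (pow_le_pow_left₀ (by positivity) h3 2).trans ?_
    rw [norm_one_sub_mul_star_sq, hqn]
    have : 0 ≤ 1 - ‖w‖ ^ 2 := by nlinarith [norm_nonneg w]
    nlinarith [mul_nonneg this (sq_nonneg ‖q₀‖)]
  have h5 : ‖evalAt η w‖ ^ 2 ≤ 1 + (1 - ‖w‖ ^ 2) / ‖q - q₀‖ ^ 2 := by
    rw [one_add_div (by positivity), le_div_iff₀ (by positivity), ← mul_pow, mul_comm]
    exact h4
  refine h5.trans ?_
  have : 0 ≤ 1 - ‖w‖ ^ 2 := by nlinarith [norm_nonneg w]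
  have : 0 < ‖w‖ - ‖q₀‖ := sub_pos.2 h0
  gcongr

/-- The boundary estimate and the maximum principle on spheres of radius `r → 1` bound `η` by
one. -/
theorem norm_evalAt_le_one {α η : ℍ⟦X⟧} {q₀ : ℍ} (h : ‖q₀‖ < 1) (hα : ConvergesOnBall α)
    (hη : ConvergesOnBall η) (hrel : denomSeries q₀ * α = linSeries q₀ * η)
    (hB : ∀ q : ℍ, ‖q‖ < 1 → ‖evalAt α q‖ ≤ 1) {q : ℍ} (hq : ‖q‖ < 1) :
    ‖evalAt η q‖ ≤ 1 := by
  have hlim : Tendsto (fun r : ℝ => √(1 + (1 - r ^ 2) / (r - ‖q₀‖) ^ 2)) (𝓝[<] 1) (𝓝 1) := by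
    have hc : ContinuousAt (fun r : ℝ => √(1 + (1 - r ^ 2) / (r - ‖q₀‖) ^ 2)) 1 := by
      have : (1 - ‖q₀‖) ^ 2 ≠ 0 := pow_ne_zero 2 (sub_pos.2 h).ne'
      fun_prop (disch := assumption)
    have := hc.tendsto.mono_left (nhdsWithin_le_nhds (s := Set.Iio 1))
    simpa using this
  refine ge_of_tendsto hlim ?_
  filter_upwards [Ioo_mem_nhdsLT (max_lt hq h)] with r hr
  have hr1 : ‖q‖ < r := (le_max_left _ _).trans_lt hr.1
  have hr2 : ‖q₀‖ < r := (le_max_right _ _).trans_lt hr.1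
  refine hη.norm_evalAt_le hr.2 (fun w hw => ?_) hr1
  subst hw
  exact Real.le_sqrt_of_sq_le (norm_sq_evalAt_le hα hη hrel hB hr2 hr.2)

/-! ### Derivatives at a zero -/

/-- On the slice of `q₀` the regular product with `q - q₀` is the pointwise one. -/
theorem evalAt_linSeries_mul_of_commute {β : ℍ⟦X⟧} (hβ : ConvergesOnBall β) {q q₀ : ℍ}
    (hq : ‖q‖ < 1) (hc : Commute q q₀) :
    evalAt (linSeries q₀ * β) q = (q - q₀) * evalAt β q := by
  have hlin : evalAt (linSeries q₀) q = q - q₀ := ((represents_linSeries q₀).2 q hq).symm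
  rw [evalAt_mul_of_commute (represents_linSeries q₀).1 hβ hq
    (by rw [hlin]; exact (Commute.refl q).sub_right hc), hlin]

theorem cullenDeriv_eq_evalAt {β : ℍ⟦X⟧} {f : ℍ → ℍ} {q₀ : ℍ} (hβ : ConvergesOnBall β)
    (hf : Represents (linSeries q₀ * β) f) (h : ‖q₀‖ < 1) :
    cullenDeriv f q₀ = evalAt β q₀ := by
  refine cullenDeriv_of_hasDerivAt ?_
  set I : imagUnits := ⟨sliceUnit q₀, sliceUnit_mem q₀⟩
  set z₀ : ℂ := ⟨q₀.re, ‖q₀.im‖⟩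
  have hI : sliceEmb I z₀ = q₀ := exists_sliceEmb_eq q₀
  have hz : z₀ ∈ Metric.ball (0 : ℂ) 1 := by
    rw [mem_ball_zero_iff, ← norm_sliceEmb I, hI]; exact h
  have hd := ((hβ.differentiableOn I).differentiableAt (Metric.isOpen_ball.mem_nhds hz)).hasDerivAt
  have key := ((hasDerivAt_id z₀).sub_const z₀).smul hd
  simp only [id, sub_self, zero_smul, one_smul, zero_add] at key
  have hval : sliceFun I (evalAt β) z₀ = (SliceModule.equiv I).symm (evalAt β q₀) := by
    rw [sliceFun, hI]
  rw [hval] at key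
  refine key.congr_of_eventuallyEq ?_
  filter_upwards [Metric.isOpen_ball.mem_nhds hz] with z hz
  have hz1 : ‖sliceEmb I z‖ < 1 := by rw [norm_sliceEmb]; exact mem_ball_zero_iff.1 hz
  have hcomm : Commute (sliceEmb I z) q₀ := hI ▸ (Commute.all z z₀).map (sliceEmb I)
  refine (SliceModule.equiv I).injective ?_
  rw [Pi.smul_apply', SliceModule.equiv_smul]
  rw [sliceFun, sliceFun, AddEquiv.apply_symm_apply, AddEquiv.apply_symm_apply, hf.2 _ hz1,
    evalAt_linSeries_mul_of_commute hβ hz1 hcomm, map_sub, hI]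

theorem sphericalDeriv_eq_evalAt {β : ℍ⟦X⟧} {f : ℍ → ℍ} {q₀ : ℍ} (hβ : ConvergesOnBall β)
    (hf : Represents (linSeries q₀ * β) f) (h : ‖q₀‖ < 1) :
    sphericalDeriv f q₀ = evalAt β (star q₀) := by
  rw [sphericalDeriv]
  split_ifs with him
  · rw [cullenDeriv_eq_evalAt hβ hf h]
    have : star q₀ = q₀ := by
      have := Quaternion.re_add_im q₀
      rw [him, add_zero] at this
      rw [← this, Quaternion.star_coe]
    rw [this]
  · have hs : ‖star q₀‖ < 1 := by rwa [Quaternion.norm_star]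
    have h0 : f q₀ = 0 := by
      rw [hf.2 q₀ h, evalAt_linSeries_mul_of_commute hβ h (Commute.refl _), sub_self, zero_mul]
    have h1 : star q₀ - q₀ = -(2 * q₀.im) := by
      rw [two_mul]
      ext <;> simp <;> ring
    have h2 : 2 * q₀.im ≠ 0 := by
      rw [two_mul, ← two_smul ℝ]
      exact smul_ne_zero two_ne_zero him
    rw [h0, hf.2 _ hs, evalAt_linSeries_mul_of_commute hβ hs (star_comm_self' q₀), h1, zero_sub,
      neg_mul, neg_neg, inv_mul_cancel_left₀ h2]

/-! ### The Schwarz-Pick estimates -/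

/-- The algebra behind the estimates. With `β` the differential quotient of `f` at its zero `q₀`
and `η = (1 - q q̄₀) * β`, the function `f` is `𝓜_{q₀} * η`, and `η` is bounded by one. -/
theorem exists_factorization {f : ℍ → ℍ} {q₀ : ℍ} (hf : IsRegularOn f unitBall)
    (hmaps : Set.MapsTo f unitBall unitBall) (hq₀ : ‖q₀‖ < 1) (hzero : f q₀ = 0) :
    ∃ η : ℍ⟦X⟧, ConvergesOnBall η ∧ ConvergesOnBall (recipSeries q₀ * η) ∧
      Represents (linSeries q₀ * (recipSeries q₀ * η)) f ∧
      ∀ q : ℍ, ‖q‖ < 1 → ‖evalAt η q‖ ≤ 1 := by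
  obtain ⟨α, hα⟩ := hf.exists_represents
  have hβ := hα.1.divLinear hq₀
  have hαβ := linSeries_mul_divLinear hα.1 hq₀ (by rw [← hα.2 q₀ hq₀, hzero])
  have hη : ConvergesOnBall (denomSeries q₀ * divLinear q₀ α) :=
    (represents_denomSeries q₀).1.mul hβ
  have hrecip : recipSeries q₀ * (denomSeries q₀ * divLinear q₀ α) = divLinear q₀ α := by
    rw [← mul_assoc, recipSeries_mul_denomSeries, one_mul]
  refine ⟨denomSeries q₀ * divLinear q₀ α, hη, by rwa [hrecip], by rwa [hrecip, hαβ], ?_⟩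
  refine fun q hq => norm_evalAt_le_one hq₀ hα.1 hη ?_ (fun q hq => ?_) hq
  · conv_lhs => rw [← hαβ]
    rw [← mul_assoc, ← mul_assoc, (commute_denomSeries_linSeries q₀).eq]
  · rw [← hα.2 q hq]
    exact le_of_lt (hmaps hq)

theorem norm_regRecip_moebiusDenom_self {q₀ : ℍ} (h : ‖q₀‖ < 1) :
    ‖regRecip (moebiusDenom q₀) q₀‖ = 1 / (1 - ‖q₀‖ ^ 2) := by
  have h1 : (1 : ℍ) - q₀ * star q₀ = ((1 - ‖q₀‖ ^ 2 : ℝ) : ℍ) := by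
    rw [Quaternion.self_mul_star, Quaternion.normSq_eq_norm_mul_self, pow_two, Quaternion.coe_sub,
      Quaternion.coe_one]
  rw [(represents_recipSeries h).2 q₀ h,
    evalAt_recipSeries_of_commute h h (star_comm_self' q₀).symm, norm_inv, h1, Quaternion.norm_coe,
    Real.norm_of_nonneg (by nlinarith [norm_nonneg q₀]), one_div]

theorem norm_regRecip_moebiusDenom_star {q₀ : ℍ} (h : ‖q₀‖ < 1) :
    ‖regRecip (moebiusDenom q₀) (star q₀)‖ = 1 / ‖1 - star q₀ ^ 2‖ := by
  have hs : ‖star q₀‖ < 1 := by rwa [Quaternion.norm_star]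
  rw [(represents_recipSeries h).2 _ hs, evalAt_recipSeries_of_commute h hs (Commute.refl _),
    norm_inv, pow_two, one_div]

end SliceRegular

theorem mainTheorem2 (f : ℍ → ℍ) (q₀ : ℍ)
    (hf : SliceRegular.IsRegularOn f SliceRegular.unitBall)
    (hmaps : Set.MapsTo f SliceRegular.unitBall SliceRegular.unitBall)
    (hq₀ : q₀ ∈ SliceRegular.unitBall) (hzero : f q₀ = 0) :
    -- the quotient `𝓜_{q₀}^{-*} * f` is a regular function on the whole ball, bounded by one
    (∃ h, SliceRegular.IsQuotientOnBall (SliceRegular.moebius q₀) f h) ∧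
    (∀ h, SliceRegular.IsQuotientOnBall (SliceRegular.moebius q₀) f h →
      (∀ q ∈ SliceRegular.unitBall, ‖h q‖ ≤ 1) ∧
      ((¬ ∃ u : ℍ, ‖u‖ = 1 ∧ ∀ q ∈ SliceRegular.unitBall, h q = u) →
        ∀ q ∈ SliceRegular.unitBall, ‖h q‖ < 1)) ∧
    -- the bound on `f`
    (∀ q ∈ SliceRegular.unitBall, ‖f q‖ ≤ ‖SliceRegular.moebius q₀ q‖) ∧
    -- the differential quotient `R_{q₀} f` is a regular function on the whole ball; its bound
    (∃ r, SliceRegular.IsDifferentialQuotient f q₀ r) ∧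
    (∀ r, SliceRegular.IsDifferentialQuotient f q₀ r →
      ∀ q ∈ SliceRegular.unitBall,
        ‖r q‖ ≤ ‖SliceRegular.regRecip (SliceRegular.moebiusDenom q₀) q‖) ∧
    -- the bounds on the derivatives
    ‖SliceRegular.cullenDeriv f q₀‖ ≤ 1 / (1 - ‖q₀‖ ^ 2) ∧
    ‖SliceRegular.sphericalDeriv f q₀‖ ≤ 1 / ‖1 - (star q₀) ^ 2‖ ∧
    -- strictness
    (¬ SliceRegular.IsMoebiusMulUnit f q₀ →
      (∀ h, SliceRegular.IsQuotientOnBall (SliceRegular.moebius q₀) f h →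
        ∀ q ∈ SliceRegular.unitBall, ‖h q‖ < 1) ∧
      (∀ q ∈ SliceRegular.unitBall, q ≠ q₀ → ‖f q‖ < ‖SliceRegular.moebius q₀ q‖) ∧
      (∀ r, SliceRegular.IsDifferentialQuotient f q₀ r →
        ∀ q ∈ SliceRegular.unitBall,
          ‖r q‖ < ‖SliceRegular.regRecip (SliceRegular.moebiusDenom q₀) q‖) ∧
      ‖SliceRegular.cullenDeriv f q₀‖ < 1 / (1 - ‖q₀‖ ^ 2) ∧
      ‖SliceRegular.sphericalDeriv f q₀‖ < 1 / ‖1 - (star q₀) ^ 2‖) := by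
  open SliceRegular in
  obtain ⟨η, hη, hβ, hf', hle⟩ := exists_factorization hf hmaps hq₀ hzero
  have hM := represents_moebius hq₀
  have hK := represents_recipSeries hq₀
  have hL := represents_linSeries q₀
  have hs : ‖star q₀‖ < 1 := by rwa [Quaternion.norm_star]
  have hfM : Represents (linSeries q₀ * recipSeries q₀ * η) f := by rwa [mul_assoc]
  have hfR : Represents (linSeries q₀ * (recipSeries q₀ * η)) (fun q => f q - f q₀) := by
    simpa only [hzero, sub_zero] using hf'
  have hquot : ∀ h, IsQuotientOnBall (moebius q₀) f h → Represents η h := fun h hh =>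
    hh.represents hM (mul_ne_zero (linSeries_ne_zero q₀) (recipSeries_ne_zero q₀)) hη hfM
  have hdiff : ∀ r, IsDifferentialQuotient f q₀ r → Represents (recipSeries q₀ * η) r :=
    fun r hr => hr.represents hL (linSeries_ne_zero q₀) hβ hfR
  have hK0 : ∀ q : ℍ, ‖q‖ < 1 → evalAt (recipSeries q₀) q ≠ 0 := fun q hq =>
    evalAt_recipSeries_ne_zero hq₀ hq
  -- Either `η` is strictly bounded by one, or it is a unimodular constant.
  have hlt_or : (∀ q : ℍ, ‖q‖ < 1 → ‖evalAt η q‖ < 1) ∨ ∃ u : ℍ, ‖u‖ = 1 ∧ η = PowerSeries.C u := by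
    by_cases hex : ∃ q : ℍ, ‖q‖ < 1 ∧ ‖evalAt η q‖ = 1
    · obtain ⟨q, hq, h1⟩ := hex
      exact Or.inr ⟨_, h1, hη.eq_C_of_norm_eq_one hle hq h1⟩
    · exact Or.inl fun q hq => (hle q hq).lt_of_ne fun h => hex ⟨q, hq, h⟩
  refine ⟨⟨_, hM.isQuotientOnBall hη hfM⟩, fun h hh => ?_, fun q hq => ?_,
    ⟨_, hL.isQuotientOnBall hβ hfR⟩, fun r hr q hq => ?_, ?_, ?_, fun hnot => ?_⟩
  · have hrep := hquot h hh
    refine ⟨fun q hq => by rw [hrep.2 q hq]; exact hle q hq, fun hno q hq => ?_⟩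
    rcases hlt_or with hlt | ⟨u, hu, rfl⟩
    · rw [hrep.2 q hq]
      exact hlt q hq
    · exact absurd ⟨u, hu, fun q hq => by rw [hrep.2 q hq, ← (represents_C u).2 q hq]⟩ hno
  · rw [hfM.2 q hq, hM.2 q hq]
    exact norm_evalAt_mul_le hM.1 hη hle hq
  · rw [(hdiff r hr).2 q hq, hK.2 q hq]
    exact norm_evalAt_mul_le hK.1 hη hle hq
  · rw [cullenDeriv_eq_evalAt hβ hf' hq₀, ← norm_regRecip_moebiusDenom_self hq₀, hK.2 _ hq₀]
    exact norm_evalAt_mul_le hK.1 hη hle hq₀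
  · rw [sphericalDeriv_eq_evalAt hβ hf' hq₀, ← norm_regRecip_moebiusDenom_star hq₀, hK.2 _ hs]
    exact norm_evalAt_mul_le hK.1 hη hle hs
  · rcases hlt_or with hlt | ⟨u, hu, rfl⟩
    · refine ⟨fun h hh q hq => by rw [(hquot h hh).2 q hq]; exact hlt q hq, fun q hq hne => ?_,
        fun r hr q hq => ?_, ?_, ?_⟩
      · rw [hfM.2 q hq, hM.2 q hq]
        exact norm_evalAt_mul_lt hM.1 hη hlt hq (hM.2 q hq ▸ moebius_ne_zero hq₀ hq hne)
      · rw [(hdiff r hr).2 q hq, hK.2 q hq]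
        exact norm_evalAt_mul_lt hK.1 hη hlt hq (hK0 q hq)
      · rw [cullenDeriv_eq_evalAt hβ hf' hq₀, ← norm_regRecip_moebiusDenom_self hq₀, hK.2 _ hq₀]
        exact norm_evalAt_mul_lt hK.1 hη hlt hq₀ (hK0 _ hq₀)
      · rw [sphericalDeriv_eq_evalAt hβ hf' hq₀, ← norm_regRecip_moebiusDenom_star hq₀, hK.2 _ hs]
        exact norm_evalAt_mul_lt hK.1 hη hlt hs (hK0 _ hs)
    · refine absurd ⟨u, hu, fun q hq => ?_⟩ hnot
      rw [hfM.2 q hq, hM.2 q hq, evalAt_mul_C hM.1 hq]
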